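/- Let $p,q\ge 0$ be integers, $n=p+q$, and let $\mathcal{C}\ell_{p,q}$ be the real Clifford algebra of the quadratic form $x_1^2+\cdots+x_p^2-x_{p+1}^2-\cdots-x_n^2$ on $\mathbb{R}^n$, with identity element $e$ and generators $e_1,\dots,e_n$ satisfying $e_ae_b+e_be_a=2\eta_{ab}e$, where $\eta=\mathrm{diag}(1,\dots,1,-1,\dots,-1)$ with $p$ entries $1$ and $q$ entries $-1$. For an ordered multi-index $A=a_1\dots a_k$, $1\le a_1<\cdots<a_k\le n$, $0\le k\le n$, put $e_A=e_{a_1}\cdots e_{a_k}$ (with $e_\varnothing=e$); these $2^n$ elements form a basis of $\mathcal{C}\ell_{p,q}$. Let $P$ be the number of basis elements $e_A$ with $(e_A)^2=e$ and $Q$ the number of basis elements $e_A$ with $(e_A)^2=-e$. The pair $(P,Q)$ is called the exterior signature of $\mathcal{C}\ell_{p,q}$. **Theorem.** 1. For all $p,q\ge 0$, $$P=2^{\frac{n-1}{2}}\Bigl(2^{\frac{n-1}{2}}+\sin\frac{\pi(p-q+1)}{4}\Bigr),\qquad Q=2^{\frac{n-1}{2}}\Bigl(2^{\frac{n-1}{2}}-\sin\frac{\pi(p-q+1)}{4}\Bigr).$$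 2. Two Clifford algebras $\mathcal{C}\ell_{p_1,q_1}$ and $\mathcal{C}\ell_{p_2,q_2}$ are isomorphic (as associative unital real algebras) if and only if their exterior signatures coincide, $(P_1,Q_1)=(P_2,Q_2)$. 3. If moreover $p_1+q_1=p_2+q_2$, then $\mathcal{C}\ell_{p_1,q_1}$ and $\mathcal{C}\ell_{p_2,q_2}$ are isomorphic if and only if $P_1-Q_1=P_2-Q_2$. -/

import Mathlib

noncomputable section

namespace RealClifford

/-- The diagonal entries `η_aa`: the first `p` are `1`, the remaining `q` are `-1`. -/
def eta (p q : ℕ) (a : Fin (p + q)) : ℝ := if (a : ℕ) < p then 1 else -1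

/-- The quadratic form `x₁² + ⋯ + x_p² - x_{p+1}² - ⋯ - x_{p+q}²` on `ℝ^(p+q)`. -/
def form (p q : ℕ) : QuadraticForm ℝ (Fin (p + q) → ℝ) :=
  QuadraticMap.weightedSumSquares ℝ (eta p q)

/-- The real nondegenerate Clifford algebra `Cl_{p,q}`. -/
abbrev Cl (p q : ℕ) : Type := CliffordAlgebra (form p q)

/-- The generator `e_a` of `Cl_{p,q}`. -/
def gen (p q : ℕ) (a : Fin (p + q)) : Cl p q :=
  CliffordAlgebra.ι (form p q) (Pi.single a 1)

/-- The element `e_A = e_{a₁} e_{a₂} ⋯ e_{a_k}` for an ordered multi-index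
`A = {a₁ < a₂ < ⋯ < a_k}`; for `A = ∅` it is the identity. -/
def blade (p q : ℕ) (A : Finset (Fin (p + q))) : Cl p q :=
  ((A.sort (· ≤ ·)).map (gen p q)).prod

theorem gen_mul_self (p q : ℕ) (a : Fin (p + q)) :
    gen p q a * gen p q a = algebraMap ℝ (Cl p q) (eta p q a) := by
  rw [gen, CliffordAlgebra.ι_sq_scalar]
  congr 1
  simp [form, QuadraticMap.weightedSumSquares_apply, Pi.single_apply]

theorem polar_single (p q : ℕ) {a b : Fin (p + q)} (h : a ≠ b) :
    QuadraticMap.polar (form p q) (Pi.single a 1) (Pi.single b 1) = 0 := by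
  simp only [QuadraticMap.polar, form, QuadraticMap.weightedSumSquares_apply, smul_eq_mul,
    ← Finset.sum_sub_distrib]
  refine Finset.sum_eq_zero fun i _ => ?_
  by_cases hia : i = a
  · subst hia
    simp [h]
  · simp [Pi.single_apply, hia]

theorem gen_mul_gen_add_swap (p q : ℕ) {a b : Fin (p + q)} (h : a ≠ b) :
    gen p q a * gen p q b + gen p q b * gen p q a = 0 := by
  rw [gen, gen, CliffordAlgebra.ι_mul_ι_add_swap, polar_single p q h, map_zero]

theorem contractLeft_prod_eq_zero {V : Type*} [AddCommGroup V] [Module ℝ V]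
    (Q : QuadraticForm ℝ V) (d : Module.Dual ℝ V) (l : List V) (h : ∀ v ∈ l, d v = 0) :
    CliffordAlgebra.contractLeft (Q := Q) d (l.map (CliffordAlgebra.ι Q)).prod = 0 := by
  induction l with
  | nil => simp
  | cons v l ih =>
    rw [List.map_cons, List.prod_cons, CliffordAlgebra.contractLeft_ι_mul, h v (by simp),
      ih fun w hw => h w (by simp [hw])]
    simp

/-- Under the canonical linear isomorphism with the exterior algebra, a Clifford product of
distinct generators corresponds to their exterior product. -/
theorem equivExterior_prod (p q : ℕ) (l : List (Fin (p + q))) (hl : l.Nodup) :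
    CliffordAlgebra.equivExterior (form p q) (l.map (gen p q)).prod =
      (l.map fun a => ExteriorAlgebra.ι ℝ (Pi.single a (1 : ℝ) : Fin (p + q) → ℝ)).prod := by
  induction l with
  | nil => exact CliffordAlgebra.changeForm_one CliffordAlgebra.changeForm.associated_neg_proof
  | cons a l ih =>
    rw [List.nodup_cons] at hl
    have ih' := ih hl.2
    rw [List.map_cons, List.prod_cons, List.map_cons, List.prod_cons, ← ih', gen]
    refine (CliffordAlgebra.changeForm_ι_mul
      CliffordAlgebra.changeForm.associated_neg_proof _ _).trans ?_
    refine sub_eq_self.2 ?_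
    refine (congrArg _ ih').trans ?_
    have := contractLeft_prod_eq_zero (0 : QuadraticForm ℝ (Fin (p + q) → ℝ))
      (QuadraticMap.associated (R := ℝ) (-(form p q)) (Pi.single a 1))
      (l.map fun b => Pi.single b 1) (by
        intro v hv
        obtain ⟨b, hb, rfl⟩ := List.mem_map.1 hv
        have hab : a ≠ b := fun h => hl.1 (h ▸ hb)
        have := polar_single p q hab
        simp only [QuadraticMap.polar] at this
        rw [QuadraticMap.associated_apply]
        simp only [neg_apply]
        rw [show -(form p q) (Pi.single a 1 + Pi.single b 1) - -(form p q) (Pi.single a 1) -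
          -(form p q) (Pi.single b 1) = 0 by linarith, smul_zero])
    rwa [List.map_map] at this

theorem equivExterior_blade (p q : ℕ) (A : Finset (Fin (p + q))) :
    CliffordAlgebra.equivExterior (form p q) (blade p q A) =
      (Pi.basisFun ℝ (Fin (p + q))).ExteriorAlgebra A := by
  rw [blade, equivExterior_prod p q _ (A.sort_nodup _), ExteriorAlgebra.basis_apply_ofCard _ rfl,
    ExteriorAlgebra.ιMulti_family, ExteriorAlgebra.ιMulti_apply, ← A.listMap_orderEmbOfFin_finRange rfl, List.map_map,
    List.ofFn_eq_map]
  congr 1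
  refine List.map_congr_left fun i _ => ?_
  simp [Set.powersetCard.ofFinEmbEquiv_symm_apply]

/-- The basis of `Cl_{p,q}` consisting of the elements `e_A`. -/
def bladeBasis (p q : ℕ) : Module.Basis (Finset (Fin (p + q))) ℝ (Cl p q) :=
  (Pi.basisFun ℝ (Fin (p + q))).ExteriorAlgebra.map
    (CliffordAlgebra.equivExterior (form p q)).symm

theorem bladeBasis_apply (p q : ℕ) (A : Finset (Fin (p + q))) :
    bladeBasis p q A = blade p q A := by
  rw [bladeBasis, Module.Basis.map_apply, ← equivExterior_blade, LinearEquiv.symm_apply_apply]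

/-- The number `P` of basis elements `e_A` of `Cl_{p,q}` with `(e_A)² = e`. -/
def numPos (p q : ℕ) : ℕ := {A : Finset (Fin (p + q)) | blade p q A * blade p q A = 1}.ncard

/-- The number `Q` of basis elements `e_A` of `Cl_{p,q}` with `(e_A)² = -e`. -/
def numNeg (p q : ℕ) : ℕ := {A : Finset (Fin (p + q)) | blade p q A * blade p q A = -1}.ncard

/-- The exterior signature `(P, Q)` of `Cl_{p,q}`. -/
def exteriorSignature (p q : ℕ) : ℕ × ℕ := (numPos p q, numNeg p q)

end RealClifford

end

namespace RealClifford

/-! Each `e_A` squares to a sign, `(-1) ^ (|A| choose 2)` times the product of its `η_aa`. Since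
`(-1) ^ (k choose 2) = Re ((1 - i) i ^ k)`, summing over all `A` factorises: `P - Q = Re ((1 - i) (1
+ i) ^ p (1 - i) ^ q)`. Polar form and `P + Q = 2 ^ n` give the formulas.

The signature is an invariant because `x ↦ tr (y ↦ x * x * y)` is defined by the algebra alone. The
`e_A` are orthogonal for it with values `± 2 ^ n`, so by Sylvester's law its positive index is `P`;
the dimension then fixes `Q`.

Conversely, equal signatures force equal `n` and equal sines, so `p₂ - q₂` is `p₁ - q₁` or `2 - (p₁
- q₁)` modulo 8. These cases are realised by `Cl p (q + 4) ≃ Cl (p + 4) q` and `Cl (q + 1) p ≃ Cl (p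
+ 1) q`, both obtained by choosing new anticommuting generators. -/

theorem eta_mul_self (p q : ℕ) (a : Fin (p + q)) : eta p q a * eta p q a = 1 := by
  unfold eta; split_ifs <;> norm_num

theorem gen_mul_gen (p q : ℕ) {a b : Fin (p + q)} (h : a ≠ b) :
    gen p q a * gen p q b = -(gen p q b * gen p q a) :=
  eq_neg_of_add_eq_zero_left (gen_mul_gen_add_swap p q h)

theorem finrank_Cl (p q : ℕ) : Module.finrank ℝ (Cl p q) = 2 ^ (p + q) := by
  rw [Module.finrank_eq_card_basis (bladeBasis p q)]
  simp

instance finite_Cl (p q : ℕ) : Module.Finite ℝ (Cl p q) :=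
  Module.Finite.of_basis (bladeBasis p q)

theorem ι_eq_sum_gen (p q : ℕ) (v : Fin (p + q) → ℝ) :
    CliffordAlgebra.ι (form p q) v = ∑ a, v a • gen p q a := by
  conv_lhs => rw [pi_eq_sum_univ' v]
  rw [map_sum]
  refine Finset.sum_congr rfl fun a _ => ?_
  rw [gen, ← map_smul]

theorem adjoin_range_gen (p q : ℕ) : Algebra.adjoin ℝ (Set.range (gen p q)) = ⊤ := by
  rw [eq_top_iff, ← CliffordAlgebra.adjoin_range_ι (Q := form p q)]
  refine Algebra.adjoin_le ?_
  rintro _ ⟨v, rfl⟩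
  rw [ι_eq_sum_gen]
  exact sum_mem fun a _ => Subalgebra.smul_mem _ (Algebra.subset_adjoin (Set.mem_range_self a)) _

/-! ### Maps out of `Cl p q` from generators and relations -/

section Lift

variable {A : Type*} [Ring A] [Algebra ℝ A]

/-- Adding the expansion of the square to the same expansion with factors swapped leaves only
anticommutators, which vanish off the diagonal. -/
theorem sum_smul_mul_self {ι : Type*} [Fintype ι] [DecidableEq ι] (g : ι → A) (η : ι → ℝ)
    (hsq : ∀ a, g a * g a = algebraMap ℝ A (η a))
    (hanti : ∀ a b, a ≠ b → g a * g b = -(g b * g a)) (v : ι → ℝ) :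
    (∑ a, v a • g a) * (∑ a, v a • g a) =
      algebraMap ℝ A (QuadraticMap.weightedSumSquares ℝ η v) := by
  have key : (∑ a, v a • g a) * (∑ a, v a • g a) =
      ∑ a, ∑ b, (v a * v b) • (g a * g b) := by
    simp [Finset.sum_mul_sum, smul_smul, mul_comm]
  have key' : (∑ a, v a • g a) * (∑ a, v a • g a) =
      ∑ a, ∑ b, (v a * v b) • (g b * g a) := by
    rw [key, Finset.sum_comm]
    simp [mul_comm]
  have hadd : (∑ a, v a • g a) * (∑ a, v a • g a) + (∑ a, v a • g a) * (∑ a, v a • g a) =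
      (2 : ℝ) • algebraMap ℝ A (QuadraticMap.weightedSumSquares ℝ η v) := by
    nth_rewrite 1 [key]
    rw [key', ← Finset.sum_add_distrib, QuadraticMap.weightedSumSquares_apply, map_sum,
      Finset.smul_sum]
    refine Finset.sum_congr rfl fun a _ => ?_
    rw [← Finset.sum_add_distrib, Finset.sum_eq_single a]
    · rw [hsq, ← two_smul ℝ, Algebra.algebraMap_eq_smul_one, Algebra.algebraMap_eq_smul_one,
        smul_smul (v a * v a), smul_eq_mul, mul_comm (η a)]
    · intro b _ hb
      rw [hanti a b hb.symm, smul_neg, neg_add_cancel]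
    · simp
  rw [← two_smul ℝ] at hadd
  exact smul_right_injective A two_ne_zero hadd

/-- Elements of an algebra that satisfy the defining relations of `Cl p q` are the images of the
generators under an algebra homomorphism. -/
theorem exists_algHom_gen (p q : ℕ) (g : Fin (p + q) → A)
    (hsq : ∀ a, g a * g a = algebraMap ℝ A (eta p q a))
    (hanti : ∀ a b, a ≠ b → g a * g b = -(g b * g a)) :
    ∃ f : Cl p q →ₐ[ℝ] A, ∀ a, f (gen p q a) = g a := by
  have hlin (v : Fin (p + q) → ℝ) :
      Fintype.linearCombination ℝ g v * Fintype.linearCombination ℝ g v =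
        algebraMap ℝ A (form p q v) := by
    rw [Fintype.linearCombination_apply]
    exact sum_smul_mul_self g (eta p q) hsq hanti v
  refine ⟨CliffordAlgebra.lift (form p q) ⟨Fintype.linearCombination ℝ g, hlin⟩, fun a => ?_⟩
  rw [gen, CliffordAlgebra.lift_ι_apply]
  simp

/-- Generation makes the induced map surjective, and equality of dimensions then makes it injective.
-/
theorem exists_algEquiv_gen (p q : ℕ) (g : Fin (p + q) → A)
    (hsq : ∀ a, g a * g a = algebraMap ℝ A (eta p q a))
    (hanti : ∀ a b, a ≠ b → g a * g b = -(g b * g a))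
    (hgen : Algebra.adjoin ℝ (Set.range g) = ⊤) (hdim : Module.finrank ℝ A = 2 ^ (p + q)) :
    ∃ f : Cl p q ≃ₐ[ℝ] A, ∀ a, f (gen p q a) = g a := by
  obtain ⟨f, hf⟩ := exists_algHom_gen p q g hsq hanti
  have hsurj : Function.Surjective f := by
    rw [← AlgHom.range_eq_top, eq_top_iff, ← hgen]
    refine Algebra.adjoin_le ?_
    rintro _ ⟨a, rfl⟩
    exact ⟨_, hf a⟩
  have : Module.Finite ℝ A := Module.Finite.of_surjective f.toLinearMap hsurj
  have hinj : Function.Injective f :=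
    (LinearMap.injective_iff_surjective_of_finrank_eq_finrank (f := f.toLinearMap)
      ((finrank_Cl p q).trans hdim.symm)).2 hsurj
  exact ⟨AlgEquiv.ofBijective f ⟨hinj, hsurj⟩, hf⟩

end Lift

/-- The automorphism of `Cl p q` that changes the sign of one generator. -/
theorem exists_reflection (p q : ℕ) (a : Fin (p + q)) :
    ∃ f : Cl p q ≃ₐ[ℝ] Cl p q,
      ∀ b, f (gen p q b) = if b = a then -gen p q b else gen p q b := by
  refine exists_algEquiv_gen p q _ (fun b => ?_) (fun b c h => ?_) ?_ (finrank_Cl p q)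
  · split_ifs <;> simp [gen_mul_self]
  · have := gen_mul_gen p q h
    split_ifs <;> simp [this]
  · rw [eq_top_iff, ← adjoin_range_gen]
    refine Algebra.adjoin_le ?_
    rintro _ ⟨b, rfl⟩
    by_cases h : b = a
    · have := Algebra.subset_adjoin (R := ℝ) (s := Set.range fun b =>
        if b = a then -gen p q b else gen p q b) ⟨b, rfl⟩
      simp only [h, if_true] at this ⊢
      simpa using Subalgebra.neg_mem _ this
    · exact Algebra.subset_adjoin ⟨b, by simp [h]⟩

theorem reflection_prod (p q : ℕ) (a : Fin (p + q)) (f : Cl p q ≃ₐ[ℝ] Cl p q)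
    (hf : ∀ b, f (gen p q b) = if b = a then -gen p q b else gen p q b)
    (l : List (Fin (p + q))) :
    f (l.map (gen p q)).prod = (-1 : ℝ) ^ l.count a • (l.map (gen p q)).prod := by
  induction l with
  | nil => simp
  | cons b l ih =>
    rw [List.map_cons, List.prod_cons, map_mul, ih, hf, List.count_cons]
    by_cases h : b = a <;> simp [h, pow_succ]

theorem reflection_blade (p q : ℕ) (a : Fin (p + q)) (f : Cl p q ≃ₐ[ℝ] Cl p q)
    (hf : ∀ b, f (gen p q b) = if b = a then -gen p q b else gen p q b)
    (A : Finset (Fin (p + q))) :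
    f (blade p q A) = if a ∈ A then -blade p q A else blade p q A := by
  rw [blade, reflection_prod p q a f hf, List.Nodup.count (A.sort_nodup _)]
  simp only [Finset.mem_sort]
  split_ifs <;> simp

/-! ### Squares of the basis elements -/

theorem gen_mul_prod (p q : ℕ) (a : Fin (p + q)) (l : List (Fin (p + q))) (h : a ∉ l) :
    gen p q a * (l.map (gen p q)).prod =
      (-1 : ℝ) ^ l.length • ((l.map (gen p q)).prod * gen p q a) := by
  induction l with
  | nil => simp
  | cons b l ih =>
    rw [List.mem_cons, not_or] at h
    rw [List.map_cons, List.prod_cons, ← mul_assoc, gen_mul_gen p q h.1, neg_mul, mul_assoc,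
      ih h.2, List.length_cons, pow_succ]
    simp [mul_assoc]

/-- Bringing the two copies of the head together moves one past the tail, at a cost of `(-1) ^
l.length`; these exponents add up to the binomial coefficient. -/
theorem prod_mul_self (p q : ℕ) (l : List (Fin (p + q))) (h : l.Nodup) :
    (l.map (gen p q)).prod * (l.map (gen p q)).prod =
      algebraMap ℝ (Cl p q) ((-1) ^ l.length.choose 2 * (l.map (eta p q)).prod) := by
  induction l with
  | nil => simp
  | cons a l ih =>
    rw [List.nodup_cons] at h
    have hc : (l.map (gen p q)).prod * gen p q a =
        (-1 : ℝ) ^ l.length • (gen p q a * (l.map (gen p q)).prod) := by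
      rw [gen_mul_prod p q a l h.1, smul_smul, ← mul_pow]
      simp
    rw [List.map_cons, List.prod_cons, mul_assoc, ← mul_assoc _ (gen p q a), hc,
      smul_mul_assoc, mul_smul_comm, mul_assoc, ← mul_assoc, gen_mul_self, ih h.2,
      List.length_cons, List.map_cons, List.prod_cons, Nat.choose_succ_succ' l.length 1,
      Nat.choose_one_right, ← map_mul, Algebra.smul_def, ← map_mul, pow_add]
    congr 1
    ring

/-- The sign of the square of `e_A`. -/
noncomputable def bladeSign (p q : ℕ) (A : Finset (Fin (p + q))) : ℝ :=
  (-1) ^ A.card.choose 2 * ∏ a ∈ A, eta p q a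

theorem blade_mul_self (p q : ℕ) (A : Finset (Fin (p + q))) :
    blade p q A * blade p q A = algebraMap ℝ (Cl p q) (bladeSign p q A) := by
  rw [blade, prod_mul_self p q _ (A.sort_nodup _), bladeSign, Finset.length_sort]
  congr 2
  rw [Finset.prod_eq_multiset_prod, ← Multiset.prod_coe, ← Multiset.map_coe, Finset.sort_eq]

theorem bladeSign_eq_one_or (p q : ℕ) (A : Finset (Fin (p + q))) :
    bladeSign p q A = 1 ∨ bladeSign p q A = -1 := by
  rw [← mul_self_eq_one_iff, bladeSign, mul_mul_mul_comm, ← mul_pow, ← Finset.prod_mul_distrib]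
  simp [eta_mul_self]

/-! ### The numbers `P` and `Q` -/

instance nontrivial_Cl (p q : ℕ) : Nontrivial (Cl p q) :=
  Module.nontrivial_of_finrank_pos (R := ℝ) (by rw [finrank_Cl]; positivity)

theorem blade_mul_self_eq_one_iff (p q : ℕ) (A : Finset (Fin (p + q))) :
    blade p q A * blade p q A = 1 ↔ bladeSign p q A = 1 := by
  rw [blade_mul_self, ← map_one (algebraMap ℝ (Cl p q))]
  exact (algebraMap ℝ (Cl p q)).injective.eq_iff

theorem blade_mul_self_eq_neg_one_iff (p q : ℕ) (A : Finset (Fin (p + q))) :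
    blade p q A * blade p q A = -1 ↔ bladeSign p q A = -1 := by
  rw [blade_mul_self, ← map_one (algebraMap ℝ (Cl p q)), ← map_neg]
  exact (algebraMap ℝ (Cl p q)).injective.eq_iff

theorem numPos_eq_card (p q : ℕ) :
    numPos p q = (Finset.univ.filter fun A => bladeSign p q A = 1).card := by
  simp only [numPos, blade_mul_self_eq_one_iff]
  rw [← Set.ncard_coe_finset]
  simp

theorem numNeg_eq_card (p q : ℕ) :
    numNeg p q = (Finset.univ.filter fun A => ¬ bladeSign p q A = 1).card := by
  have h (A : Finset (Fin (p + q))) : bladeSign p q A = -1 ↔ ¬ bladeSign p q A = 1 := by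
    rcases bladeSign_eq_one_or p q A with h | h <;> rw [h] <;> norm_num
  simp only [numNeg, blade_mul_self_eq_neg_one_iff, h]
  rw [← Set.ncard_coe_finset]
  simp

theorem numPos_add_numNeg (p q : ℕ) : numPos p q + numNeg p q = 2 ^ (p + q) := by
  rw [numPos_eq_card, numNeg_eq_card, Finset.card_filter_add_card_filter_not]
  simp

theorem numPos_sub_numNeg (p q : ℕ) :
    (numPos p q : ℝ) - numNeg p q = ∑ A, bladeSign p q A := by
  rw [← Finset.sum_filter_add_sum_filter_not Finset.univ (fun A => bladeSign p q A = 1),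
    Finset.sum_congr rfl fun A hA => (Finset.mem_filter.1 hA).2,
    Finset.sum_congr (g := fun _ => (-1 : ℝ)) rfl fun A hA =>
      (bladeSign_eq_one_or p q A).resolve_left (Finset.mem_filter.1 hA).2,
    numPos_eq_card, numNeg_eq_card]
  simp [sub_eq_add_neg]

open Complex in
-- Both sides run through `1, 1, -1, -1` periodically and change sign under `k ↦ k + 2`.
theorem neg_one_pow_choose_two (k : ℕ) :
    (-1 : ℝ) ^ k.choose 2 = ((1 - I) * I ^ k).re := by
  induction k using Nat.twoStepInduction with
  | zero => simp
  | one => simp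
  | more k ih _ =>
    have h : (k + 2).choose 2 = k.choose 2 + 2 * k + 1 := by
      rw [Nat.choose_succ_succ' (k + 1) 1, Nat.choose_succ_succ' k 1]
      simp only [Nat.choose_one_right]
      ring
    rw [h, pow_succ, pow_add, pow_mul, ih, pow_add, I_sq]
    simp

theorem prod_one_add_eta_mul_I (p q : ℕ) :
    ∏ a, (1 + (eta p q a : ℂ) * Complex.I) = (1 + Complex.I) ^ p * (1 - Complex.I) ^ q := by
  rw [Fin.prod_univ_add]
  simp [eta, sub_eq_add_neg]

theorem sum_bladeSign_eq_re (p q : ℕ) :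
    ∑ A, bladeSign p q A =
      ((1 - Complex.I) * ((1 + Complex.I) ^ p * (1 - Complex.I) ^ q)).re := by
  rw [← prod_one_add_eta_mul_I, Finset.prod_one_add, Finset.mul_sum, Complex.re_sum,
    Finset.powerset_univ]
  refine Finset.sum_congr rfl fun A _ => ?_
  rw [Finset.prod_mul_distrib, Finset.prod_const, bladeSign, neg_one_pow_choose_two,
    ← Complex.ofReal_prod, mul_left_comm, Complex.re_ofReal_mul, mul_comm]

theorem one_add_I_eq : 1 + Complex.I = (√2 : ℝ) * Complex.exp ((Real.pi / 4 : ℝ) * Complex.I) := by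
  rw [Complex.exp_mul_I, ← Complex.ofReal_cos, ← Complex.ofReal_sin, Real.cos_pi_div_four,
    Real.sin_pi_div_four]
  have h : (√2 : ℝ) * (√2 / 2) = 1 := by
    rw [mul_div_assoc', Real.mul_self_sqrt zero_le_two, div_self two_ne_zero]
  rw [mul_add, ← mul_assoc, ← Complex.ofReal_mul, h]
  simp

theorem one_sub_I_eq :
    1 - Complex.I = (√2 : ℝ) * Complex.exp ((-(Real.pi / 4) : ℝ) * Complex.I) := by
  rw [Complex.exp_mul_I, ← Complex.ofReal_cos, ← Complex.ofReal_sin, Real.cos_neg, Real.sin_neg,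
    Real.cos_pi_div_four, Real.sin_pi_div_four]
  have h : (√2 : ℝ) * (√2 / 2) = 1 := by
    rw [mul_div_assoc', Real.mul_self_sqrt zero_le_two, div_self two_ne_zero]
  rw [mul_add, ← mul_assoc, ← Complex.ofReal_mul, ← Complex.ofReal_mul, mul_neg, h]
  simp [sub_eq_add_neg]

theorem numPos_sub_numNeg_eq_sin (p q : ℕ) :
    (numPos p q : ℝ) - numNeg p q =
      √2 ^ (p + q + 1) * Real.sin (Real.pi * ((p : ℝ) - q + 1) / 4) := by
  -- The argument is `π (p - q - 1) / 4`, written with a shift by `π / 2` so that the cosine becomes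
  -- the required sine.
  have h : (1 - Complex.I) * ((1 + Complex.I) ^ p * (1 - Complex.I) ^ q) =
      ((√2 ^ (p + q + 1) : ℝ) : ℂ) *
        Complex.exp ((Real.pi * ((p : ℝ) - q + 1) / 4 - Real.pi / 2 : ℝ) * Complex.I) := by
    rw [one_add_I_eq, one_sub_I_eq, mul_pow, mul_pow, ← Complex.exp_nat_mul,
      ← Complex.exp_nat_mul]
    calc _ = ((√2 ^ (p + q + 1) : ℝ) : ℂ) *
          (Complex.exp ((-(Real.pi / 4) : ℝ) * Complex.I) *
            (Complex.exp (p * ((Real.pi / 4 : ℝ) * Complex.I)) *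
            Complex.exp (q * ((-(Real.pi / 4) : ℝ) * Complex.I)))) := by
          push_cast
          ring
      _ = _ := by
          rw [← Complex.exp_add, ← Complex.exp_add]
          congr 2
          push_cast
          ring
  rw [numPos_sub_numNeg, sum_bladeSign_eq_re, h, Complex.re_ofReal_mul,
    Complex.exp_ofReal_mul_I_re, Real.cos_sub_pi_div_two]

theorem sqrt_two_pow_succ (n : ℕ) : √2 ^ (n + 1) = 2 * (2 : ℝ) ^ (((n : ℝ) - 1) / 2) := by
  have h := Real.rpow_add zero_lt_two 1 (((n : ℝ) - 1) / 2)
  rw [Real.rpow_one] at h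
  rw [Real.sqrt_eq_rpow, ← Real.rpow_natCast, ← Real.rpow_mul zero_le_two, ← h]
  congr 1
  push_cast
  ring

theorem two_pow_eq (n : ℕ) :
    (2 : ℝ) ^ n = 2 * ((2 : ℝ) ^ (((n : ℝ) - 1) / 2) * (2 : ℝ) ^ (((n : ℝ) - 1) / 2)) := by
  nth_rewrite 2 [← Real.rpow_one 2]
  rw [← Real.rpow_add zero_lt_two, ← Real.rpow_add zero_lt_two, ← Real.rpow_natCast]
  congr 1
  ring

theorem numPos_eq (p q : ℕ) : (numPos p q : ℝ) =
    (2 : ℝ) ^ (((p : ℝ) + (q : ℝ) - 1) / 2) * ((2 : ℝ) ^ (((p : ℝ) + (q : ℝ) - 1) / 2) +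
      Real.sin (Real.pi * ((p : ℝ) - (q : ℝ) + 1) / 4)) := by
  have h := numPos_sub_numNeg_eq_sin p q
  have h' : (numPos p q : ℝ) + numNeg p q = 2 ^ (p + q) := mod_cast numPos_add_numNeg p q
  rw [sqrt_two_pow_succ] at h
  rw [two_pow_eq] at h'
  push_cast at h h'
  linarith

theorem numNeg_eq (p q : ℕ) : (numNeg p q : ℝ) =
    (2 : ℝ) ^ (((p : ℝ) + (q : ℝ) - 1) / 2) * ((2 : ℝ) ^ (((p : ℝ) + (q : ℝ) - 1) / 2) -
      Real.sin (Real.pi * ((p : ℝ) - (q : ℝ) + 1) / 4)) := by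
  have h := numPos_sub_numNeg_eq_sin p q
  have h' : (numPos p q : ℝ) + numNeg p q = 2 ^ (p + q) := mod_cast numPos_add_numNeg p q
  rw [sqrt_two_pow_succ] at h
  rw [two_pow_eq] at h'
  push_cast at h h'
  linarith

/-! ### What the signature determines about `p` and `q` -/

theorem exteriorSignature_eq_of_sub_eq {p₁ q₁ p₂ q₂ : ℕ} (hn : p₁ + q₁ = p₂ + q₂)
    (h : (numPos p₁ q₁ : ℤ) - numNeg p₁ q₁ = numPos p₂ q₂ - numNeg p₂ q₂) :
    exteriorSignature p₁ q₁ = exteriorSignature p₂ q₂ := by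
  have h₁ := numPos_add_numNeg p₁ q₁
  rw [hn, ← numPos_add_numNeg p₂ q₂] at h₁
  rw [exteriorSignature, exteriorSignature, Prod.mk.injEq]
  omega

theorem add_eq_of_exteriorSignature_eq {p₁ q₁ p₂ q₂ : ℕ}
    (h : exteriorSignature p₁ q₁ = exteriorSignature p₂ q₂) : p₁ + q₁ = p₂ + q₂ := by
  rw [exteriorSignature, exteriorSignature, Prod.mk.injEq] at h
  apply Nat.pow_right_injective le_rfl
  change 2 ^ _ = 2 ^ _
  rw [← numPos_add_numNeg, ← numPos_add_numNeg, h.1, h.2]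

/-- For the angle `π (p - q + 1) / 4`, the period `2π` of the sine becomes 8 and the symmetry `x ↦ π
- x` becomes `p - q ↦ 2 - (p - q)`. -/
theorem eq_or_eq_of_exteriorSignature_eq {p₁ q₁ p₂ q₂ : ℕ}
    (h : exteriorSignature p₁ q₁ = exteriorSignature p₂ q₂) :
    ∃ k : ℤ, (p₂ : ℤ) - q₂ = p₁ - q₁ + 8 * k ∨ (p₂ : ℤ) - q₂ = 2 - (p₁ - q₁) + 8 * k := by
  have hn := add_eq_of_exteriorSignature_eq h
  rw [exteriorSignature, exteriorSignature, Prod.mk.injEq] at h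
  have h₁ := numPos_sub_numNeg_eq_sin p₁ q₁
  rw [h.1, h.2, numPos_sub_numNeg_eq_sin, hn] at h₁
  have h₂ := mul_left_cancel₀ (by positivity) h₁.symm
  obtain ⟨k, hk | hk⟩ := Real.sin_eq_sin_iff.1 h₂
  · refine ⟨k, Or.inl ?_⟩
    have : ((p₂ : ℝ) - q₂) = p₁ - q₁ + 8 * k := by
      have : Real.pi * ((p₂ : ℝ) - q₂) = Real.pi * (p₁ - q₁ + 8 * k) := by linarith
      exact mul_left_cancel₀ Real.pi_ne_zero this
    exact_mod_cast this
  · refine ⟨k, Or.inr ?_⟩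
    have : ((p₂ : ℝ) - q₂) = 2 - (p₁ - q₁) + 8 * k := by
      have : Real.pi * ((p₂ : ℝ) - q₂) = Real.pi * (2 - (p₁ - q₁) + 8 * k) := by linarith
      exact mul_left_cancel₀ Real.pi_ne_zero this
    exact_mod_cast this

/-! ### The trace form -/

section TraceForm

variable (A : Type*) [Ring A] [Algebra ℝ A]

/-- The quadratic form `x ↦ tr (y ↦ x * x * y)` of an algebra. -/
noncomputable def traceSq : QuadraticForm ℝ A :=
  LinearMap.BilinMap.toQuadraticMap ((LinearMap.mul ℝ A).compr₂
    (LinearMap.trace ℝ A ∘ₗ (Algebra.lmul ℝ A).toLinearMap))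

theorem traceSq_apply (x : A) :
    traceSq A x = LinearMap.trace ℝ A (Algebra.lmul ℝ A (x * x)) := rfl

variable {A}

theorem trace_lmul_algEquiv {B : Type*} [Ring B] [Algebra ℝ B] (e : A ≃ₐ[ℝ] B) (x : A) :
    LinearMap.trace ℝ B (Algebra.lmul ℝ B (e x)) = LinearMap.trace ℝ A (Algebra.lmul ℝ A x) := by
  rw [← LinearMap.trace_conj' _ e.toLinearEquiv]
  congr 1
  ext
  simp [LinearEquiv.conj_apply]

theorem traceSq_equivalent {B : Type*} [Ring B] [Algebra ℝ B] (e : A ≃ₐ[ℝ] B) :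
    (traceSq A).Equivalent (traceSq B) :=
  ⟨{ e.toLinearEquiv with
      map_app' := fun x => by
        change traceSq B (e x) = _
        rw [traceSq_apply, traceSq_apply, ← map_mul, trace_lmul_algEquiv] }⟩

end TraceForm

/-- Reflecting a generator that lies in exactly one of `A`, `B` negates the product, whereas
automorphisms preserve the trace. -/
theorem trace_lmul_blade_mul_blade (p q : ℕ) {A B : Finset (Fin (p + q))} (h : A ≠ B) :
    LinearMap.trace ℝ (Cl p q) (Algebra.lmul ℝ (Cl p q) (blade p q A * blade p q B)) = 0 := by
  obtain ⟨a, ha⟩ : ∃ a, ¬(a ∈ A ↔ a ∈ B) := by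
    by_contra! hc
    exact h (Finset.ext hc)
  obtain ⟨f, hf⟩ := exists_reflection p q a
  have hneg : f (blade p q A * blade p q B) = -(blade p q A * blade p q B) := by
    rw [map_mul, reflection_blade p q a f hf, reflection_blade p q a f hf]
    by_cases hA : a ∈ A <;> by_cases hB : a ∈ B <;> simp_all
  have := trace_lmul_algEquiv f (blade p q A * blade p q B)
  rw [hneg, map_neg, map_neg] at this
  linarith

theorem traceSq_blade (p q : ℕ) (A : Finset (Fin (p + q))) :
    traceSq (Cl p q) (blade p q A) = bladeSign p q A * 2 ^ (p + q) := by
  rw [traceSq_apply, blade_mul_self, Algebra.algebraMap_eq_smul_one, map_smul, map_smul, map_one,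
    LinearMap.trace_one, finrank_Cl]
  simp

theorem traceSq_equivalent_weightedSumSquares (p q : ℕ) :
    (traceSq (Cl p q)).Equivalent (QuadraticMap.weightedSumSquares ℝ
      fun A => traceSq (Cl p q) (bladeBasis p q A)) := by
  rw [← QuadraticMap.basisRepr_eq_of_iIsOrtho]
  · exact ⟨QuadraticMap.isometryEquivBasisRepr _ _⟩
  · intro A B h
    rw [Function.onFun, bladeBasis_apply, bladeBasis_apply]
    change QuadraticMap.associatedHom ℝ (traceSq (Cl p q)) _ _ = 0
    rw [traceSq, QuadraticMap.associated_toQuadraticMap]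
    have h₁ := trace_lmul_blade_mul_blade p q h
    have h₂ := trace_lmul_blade_mul_blade p q h.symm
    simp only [LinearMap.compr₂_apply, LinearMap.mul_apply', LinearMap.comp_apply,
      AlgHom.toLinearMap_apply, h₁, h₂, add_zero, smul_zero]

/-- The `e_A` diagonalise the form, and its diagonal entries have the signs of their squares. -/
theorem sigPos_traceSq (p q : ℕ) : sigPos (traceSq (Cl p q)) = numPos p q := by
  rw [QuadraticForm.sigPos_of_equiv_weightedSumSquares (traceSq_equivalent_weightedSumSquares p q)]
  simp only [numPos, bladeBasis_apply, traceSq_blade, blade_mul_self_eq_one_iff]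
  congr 1
  ext A
  have : (0 : ℝ) < 2 ^ (p + q) := by positivity
  rcases bladeSign_eq_one_or p q A with h | h <;> norm_num [h]

theorem exteriorSignature_eq_of_algEquiv {p₁ q₁ p₂ q₂ : ℕ} (e : Cl p₁ q₁ ≃ₐ[ℝ] Cl p₂ q₂) :
    exteriorSignature p₁ q₁ = exteriorSignature p₂ q₂ := by
  have hpos : numPos p₁ q₁ = numPos p₂ q₂ := by
    rw [← sigPos_traceSq, ← sigPos_traceSq, (traceSq_equivalent e).sigPos_eq]
  have hdim : 2 ^ (p₁ + q₁) = 2 ^ (p₂ + q₂) := by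
    rw [← finrank_Cl, ← finrank_Cl, e.toLinearEquiv.finrank_eq]
  rw [← numPos_add_numNeg, ← numPos_add_numNeg] at hdim
  rw [exteriorSignature, exteriorSignature, Prod.mk.injEq]
  omega

/-! ### Isomorphisms -/

/-- Keep one generator `z` with `z * z = 1` and replace every other `e_j` by `z * e_j`. The new
elements still anticommute, but `(z * e_j)² = -e_j²`, so the other `p` positive and `q` negative
generators exchange roles. -/
theorem nonempty_algEquiv_succ (p q : ℕ) : Nonempty (Cl (q + 1) p ≃ₐ[ℝ] Cl (p + 1) q) := by
  let z : Fin (p + 1 + q) := ⟨0, by omega⟩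
  -- Reversing the nonzero indices lists the former negative generators first, as `eta (q + 1) p`
  -- demands.
  let j (a : Fin (q + 1 + p)) : Fin (p + 1 + q) :=
    ⟨if (a : ℕ) = 0 then 0 else p + 1 + q - a, by split_ifs <;> omega⟩
  let g (a : Fin (q + 1 + p)) : Cl (p + 1) q :=
    if (a : ℕ) = 0 then gen (p + 1) q z else gen (p + 1) q z * gen (p + 1) q (j a)
  have hz : gen (p + 1) q z * gen (p + 1) q z = 1 := by
    rw [gen_mul_self]
    simp [eta, z]
  have hj {a : Fin (q + 1 + p)} (ha : (a : ℕ) ≠ 0) : j a ≠ z := by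
    simp only [j, z, ne_eq, Fin.mk.injEq, if_neg ha]
    omega
  have hzj {a : Fin (q + 1 + p)} (ha : (a : ℕ) ≠ 0) :
      gen (p + 1) q (j a) * gen (p + 1) q z = -(gen (p + 1) q z * gen (p + 1) q (j a)) :=
    gen_mul_gen _ _ (hj ha)
  have hprod {a b : Fin (q + 1 + p)} (ha : (a : ℕ) ≠ 0) :
      gen (p + 1) q z * gen (p + 1) q (j a) * (gen (p + 1) q z * gen (p + 1) q (j b)) =
        -(gen (p + 1) q (j a) * gen (p + 1) q (j b)) := by
    rw [mul_assoc, ← mul_assoc (gen (p + 1) q (j a)), hzj ha, neg_mul, mul_neg, mul_assoc,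
      ← mul_assoc, hz, one_mul]
  refine (exists_algEquiv_gen (q + 1) p g (fun a => ?_) (fun a b hab => ?_) ?_
    (by rw [finrank_Cl]; congr 1; omega)).nonempty
  · by_cases ha : (a : ℕ) = 0
    · simp only [g, if_pos ha, hz]
      simp [eta, ha]
    · simp only [g, if_neg ha]
      rw [hprod ha, gen_mul_self, ← map_neg]
      congr 1
      simp only [eta, j, if_neg ha]
      split_ifs <;> first | omega | simp
  · by_cases ha : (a : ℕ) = 0 <;> by_cases hb : (b : ℕ) = 0
    · exact absurd (Fin.ext (ha.trans hb.symm)) hab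
    · simp only [g, if_pos ha, if_neg hb]
      rw [mul_assoc _ _ (gen (p + 1) q z), hzj hb, mul_neg, neg_neg]
    · simp only [g, if_pos hb, if_neg ha]
      rw [mul_assoc _ _ (gen (p + 1) q z), hzj ha, mul_neg]
    · simp only [g, if_neg ha, if_neg hb]
      rw [hprod ha, hprod hb, gen_mul_gen]
      intro h
      simp only [j, Fin.mk.injEq, if_neg ha, if_neg hb] at h
      exact hab (Fin.ext (by omega))
  · rw [eq_top_iff, ← adjoin_range_gen]
    refine Algebra.adjoin_le ?_
    have hmem (a) : g a ∈ Algebra.adjoin ℝ (Set.range g) :=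
      Algebra.subset_adjoin (Set.mem_range_self a)
    have hz' : gen (p + 1) q z ∈ Algebra.adjoin ℝ (Set.range g) := by
      simpa [g] using hmem ⟨0, by omega⟩
    rintro _ ⟨b, rfl⟩
    by_cases hb : (b : ℕ) = 0
    · rwa [show b = z from Fin.ext hb]
    · have h := mul_mem hz' (hmem ⟨p + 1 + q - b, by omega⟩)
      have hb' : ¬ p + 1 + q - (b : ℕ) = 0 := by omega
      have hjb : j ⟨p + 1 + q - b, by omega⟩ = b := by
        simp only [j, if_neg hb']
        exact Fin.ext (by simp; omega)
      simp only [g, if_neg hb', hjb] at h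
      rwa [← mul_assoc, hz, one_mul] at h

/-- The generator anticommutes with all factors but itself, so the sign is `(-1) ^ (l.length - 1)`;
the exponent `l.length + 1` has the same parity. -/
theorem prod_mul_gen_of_mem (p q : ℕ) (a : Fin (p + q)) (l : List (Fin (p + q)))
    (hl : l.Nodup) (h : a ∈ l) :
    (l.map (gen p q)).prod * gen p q a =
      (-1 : ℝ) ^ (l.length + 1) • (gen p q a * (l.map (gen p q)).prod) := by
  induction l with
  | nil => simp at h
  | cons b l ih =>
    rw [List.nodup_cons] at hl
    rw [List.map_cons, List.prod_cons, List.length_cons]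
    by_cases hab : a = b
    · subst hab
      rw [mul_assoc, gen_mul_prod p q a l hl.1, mul_smul_comm, smul_smul, ← pow_add,
        Even.neg_one_pow ⟨l.length + 1, by ring⟩, one_smul]
    · rw [mul_assoc, ih hl.2 ((List.mem_cons.1 h).resolve_left hab), mul_smul_comm, ← mul_assoc,
        gen_mul_gen p q (Ne.symm hab), ← mul_assoc, pow_succ _ (l.length + 1)]
      simp

/-- Let `w` be the product of four positive generators. Then `w * w = 1`, and `w` anticommutes with
these four and commutes with the rest. Replacing each of the four by `e_a * w` flips its square and
keeps all anticommutation relations. -/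
theorem nonempty_algEquiv_add_four (p q : ℕ) : Nonempty (Cl p (q + 4) ≃ₐ[ℝ] Cl (p + 4) q) := by
  -- Taking the last four positive indices makes the new negative ones contiguous, so no reindexing
  -- is needed.
  let i (k : Fin 4) : Fin (p + 4 + q) := ⟨p + k, by omega⟩
  let l : List (Fin (p + 4 + q)) := [i 0, i 1, i 2, i 3]
  let E := gen (p + 4) q
  have hmem (a : Fin (p + 4 + q)) : a ∈ l ↔ p ≤ a ∧ (a : ℕ) < p + 4 := by
    simp [l, i, Fin.ext_iff]
    omega
  have hnd : l.Nodup := by simp [l, i]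
  obtain ⟨w, hw⟩ : ∃ w, w = (l.map E).prod := ⟨_, rfl⟩
  have hww : w * w = 1 := by
    rw [hw, prod_mul_self _ _ l hnd]
    have : l.map (eta (p + 4) q) = [1, 1, 1, 1] := by simp [l, i, eta]
    rw [this]
    simp [l, show Nat.choose 4 2 = 6 from rfl, show Even 6 by decide]
  have hin {a} (ha : a ∈ l) : w * E a = -(E a * w) := by
    rw [hw, prod_mul_gen_of_mem _ _ a l hnd ha]
    simp [l, E, show (-1 : ℝ) ^ 5 = -1 by norm_num]
  have hout {a} (ha : a ∉ l) : w * E a = E a * w := by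
    rw [hw, gen_mul_prod _ _ a l ha]
    simp [l, E, show (-1 : ℝ) ^ 4 = 1 by norm_num]
  have hprod {a} (ha : a ∈ l) (b) :
      E a * w * (E b * w) = if b ∈ l then -(E a * E b) else E a * E b := by
    split_ifs with hb
    · rw [mul_assoc, ← mul_assoc w, hin hb, neg_mul, mul_assoc (E b), hww, mul_one, mul_neg]
    · rw [mul_assoc, ← mul_assoc w, hout hb, mul_assoc (E b), hww, mul_one]
  let c (a : Fin (p + (q + 4))) : Fin (p + 4 + q) := ⟨a, by omega⟩
  let h (b : Fin (p + 4 + q)) : Cl (p + 4) q := if b ∈ l then E b * w else E b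
  have hanti {a b} (hab : a ≠ b) : E a * E b = -(E b * E a) := gen_mul_gen _ _ hab
  refine (exists_algEquiv_gen p (q + 4) (h ∘ c) (fun a => ?_) (fun a b hab => ?_) ?_
    (by rw [finrank_Cl]; congr 1; omega)).nonempty
  · by_cases ha : c a ∈ l
    · simp only [Function.comp_apply, h, if_pos ha]
      rw [hprod ha, if_pos ha, gen_mul_self, ← map_neg]
      rw [hmem] at ha
      simp only [c] at ha
      congr 1
      simp [eta, c, ha.2, ha.1.not_gt]
    · simp only [Function.comp_apply, h, if_neg ha]
      rw [gen_mul_self]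
      rw [hmem] at ha
      simp only [c] at ha
      congr 1
      simp only [eta, c]
      split_ifs <;> first | rfl | omega
  · have hab' : c a ≠ c b := fun h => hab (Fin.ext (by simpa [c] using h))
    by_cases ha : c a ∈ l <;> by_cases hb : c b ∈ l <;>
      simp only [Function.comp_apply, h, ha, hb, if_true, if_false]
    · rw [hprod ha, hprod hb, if_pos ha, if_pos hb, hanti hab']
    · rw [mul_assoc, hout hb, ← mul_assoc, hanti hab', neg_mul, mul_assoc]
    · rw [mul_assoc (E (c b)), hout ha, ← mul_assoc, hanti hab', neg_mul, mul_assoc]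
    · exact hanti hab'
  · have hr : Set.range (h ∘ c) = Set.range h := by
      have hc : Function.Surjective c := fun b => ⟨⟨b, by omega⟩, rfl⟩
      exact hc.range_comp h
    rw [hr, eq_top_iff, ← adjoin_range_gen]
    refine Algebra.adjoin_le ?_
    suffices hT : ∀ T : Subalgebra ℝ (Cl (p + 4) q), (∀ a, h a ∈ T) → Set.range E ⊆ T from
      hT _ fun a => Algebra.subset_adjoin (Set.mem_range_self a)
    intro T hsub
    have hil (k) : i k ∈ l := by
      rw [hmem]
      simp only [i]
      omega
    have hwm : w ∈ T := by
      -- The product of the four new generators is `(-(e₀ e₁)) (-(e₂ e₃)) = w`.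
      have := mul_mem (mul_mem (hsub (i 0)) (hsub (i 1))) (mul_mem (hsub (i 2)) (hsub (i 3)))
      simp only [h, if_pos (hil _), hprod (hil _), neg_mul_neg] at this
      rw [hw]
      simpa [l, mul_assoc] using this
    rintro _ ⟨b, rfl⟩
    by_cases hb : b ∈ l
    · have := mul_mem (hsub b) hwm
      simp only [h, if_pos hb] at this
      rwa [mul_assoc, hww, mul_one] at this
    · have := hsub b
      simp only [h, if_neg hb] at this
      exact this

theorem nonempty_algEquiv_add_four_mul (p q k : ℕ) :
    Nonempty (Cl p (q + 4 * k) ≃ₐ[ℝ] Cl (p + 4 * k) q) := by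
  induction k generalizing q with
  | zero => exact ⟨AlgEquiv.refl⟩
  | succ k ih =>
    obtain ⟨f⟩ := ih (q + 4)
    obtain ⟨g⟩ := nonempty_algEquiv_add_four (p + 4 * k) q
    rw [show q + 4 * (k + 1) = q + 4 + 4 * k by ring, show p + 4 * (k + 1) = p + 4 * k + 4 by ring]
    exact ⟨f.trans g⟩

theorem nonempty_algEquiv_of_sub_eq_add_eight_mul {p₁ q₁ p₂ q₂ : ℕ} (hn : p₁ + q₁ = p₂ + q₂)
    {k : ℤ} (h : (p₂ : ℤ) - q₂ = p₁ - q₁ + 8 * k) : Nonempty (Cl p₁ q₁ ≃ₐ[ℝ] Cl p₂ q₂) := by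
  obtain ⟨m, rfl | rfl⟩ := k.eq_nat_or_neg
  · obtain rfl : p₂ = p₁ + 4 * m := by omega
    obtain rfl : q₁ = q₂ + 4 * m := by omega
    exact nonempty_algEquiv_add_four_mul _ _ _
  · obtain rfl : p₁ = p₂ + 4 * m := by omega
    obtain rfl : q₂ = q₁ + 4 * m := by omega
    exact (nonempty_algEquiv_add_four_mul _ _ _).map AlgEquiv.symm

theorem nonempty_algEquiv_of_exteriorSignature_eq {p₁ q₁ p₂ q₂ : ℕ}
    (h : exteriorSignature p₁ q₁ = exteriorSignature p₂ q₂) :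
    Nonempty (Cl p₁ q₁ ≃ₐ[ℝ] Cl p₂ q₂) := by
  have hn := add_eq_of_exteriorSignature_eq h
  obtain ⟨k, hk | hk⟩ := eq_or_eq_of_exteriorSignature_eq h
  · exact nonempty_algEquiv_of_sub_eq_add_eight_mul hn hk
  -- The swap needs a positive generator in one of the algebras, and sends `p - q` to `2 - (p - q)`.
  -- If neither has one, equal `n` makes them identical.
  · rcases p₁ with _ | p₁
    · rcases p₂ with _ | p₂
      · obtain rfl : q₁ = q₂ := by omega
        exact ⟨AlgEquiv.refl⟩
      · obtain ⟨f⟩ := nonempty_algEquiv_succ p₂ q₂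
        obtain ⟨g⟩ := nonempty_algEquiv_of_sub_eq_add_eight_mul (p₁ := 0) (q₁ := q₁)
          (p₂ := q₂ + 1) (q₂ := p₂) (k := -k) (by omega) (by push_cast at hk ⊢; omega)
        exact ⟨g.trans f⟩
    · obtain ⟨f⟩ := nonempty_algEquiv_succ q₁ p₁
      obtain ⟨g⟩ := nonempty_algEquiv_of_sub_eq_add_eight_mul (p₁ := q₁ + 1) (q₁ := p₁)
        (p₂ := p₂) (q₂ := q₂) (k := k) (by omega) (by push_cast at hk ⊢; omega)
      exact ⟨f.trans g⟩

theorem nonempty_algEquiv_iff (p₁ q₁ p₂ q₂ : ℕ) :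
    Nonempty (Cl p₁ q₁ ≃ₐ[ℝ] Cl p₂ q₂) ↔ exteriorSignature p₁ q₁ = exteriorSignature p₂ q₂ :=
  ⟨fun ⟨e⟩ => exteriorSignature_eq_of_algEquiv e, nonempty_algEquiv_of_exteriorSignature_eq⟩

end RealClifford

theorem mainTheorem5 :
    (∀ p q : ℕ,
      (RealClifford.numPos p q : ℝ) =
        (2 : ℝ) ^ (((p : ℝ) + (q : ℝ) - 1) / 2) *
          ((2 : ℝ) ^ (((p : ℝ) + (q : ℝ) - 1) / 2) +
            Real.sin (Real.pi * ((p : ℝ) - (q : ℝ) + 1) / 4)) ∧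
      (RealClifford.numNeg p q : ℝ) =
        (2 : ℝ) ^ (((p : ℝ) + (q : ℝ) - 1) / 2) *
          ((2 : ℝ) ^ (((p : ℝ) + (q : ℝ) - 1) / 2) -
            Real.sin (Real.pi * ((p : ℝ) - (q : ℝ) + 1) / 4))) ∧
    (∀ p₁ q₁ p₂ q₂ : ℕ,
      Nonempty (RealClifford.Cl p₁ q₁ ≃ₐ[ℝ] RealClifford.Cl p₂ q₂) ↔
        RealClifford.exteriorSignature p₁ q₁ = RealClifford.exteriorSignature p₂ q₂) ∧
    (∀ p₁ q₁ p₂ q₂ : ℕ, p₁ + q₁ = p₂ + q₂ →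
      (Nonempty (RealClifford.Cl p₁ q₁ ≃ₐ[ℝ] RealClifford.Cl p₂ q₂) ↔
        (RealClifford.numPos p₁ q₁ : ℤ) - (RealClifford.numNeg p₁ q₁ : ℤ) =
          (RealClifford.numPos p₂ q₂ : ℤ) - (RealClifford.numNeg p₂ q₂ : ℤ))) :=
  ⟨fun p q => ⟨RealClifford.numPos_eq p q, RealClifford.numNeg_eq p q⟩,
    RealClifford.nonempty_algEquiv_iff,
    fun p₁ q₁ p₂ q₂ hn => (RealClifford.nonempty_algEquiv_iff p₁ q₁ p₂ q₂).trans
      ⟨fun h => by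
        rw [RealClifford.exteriorSignature, RealClifford.exteriorSignature, Prod.mk.injEq] at h
        rw [h.1, h.2],
      RealClifford.exteriorSignature_eq_of_sub_eq hn⟩⟩
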